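/- Let $(a_n)_{n\ge 0}$ be a sequence of real numbers that is periodic with minimal period $p$, where $p\ge 2$ is even, and consider the difference equation $$x_{n+1}=x_{n-1}e^{a_n-x_{n-1}-x_n},\qquad n\ge 0, \qquad (*)$$ whose solutions are real sequences $(x_n)_{n\ge -1}$. Call a solution $(\bar x_n)_{n\ge -1}$ of $(*)$ globally attracting if $\lim_{n\to\infty}(x_n-\bar x_n)=0$ for every solution $(x_n)_{n\ge -1}$ of $(*)$ with $x_{-1}>0$ and $x_0>0$. Let $$\sigma=\sum_{j=1}^{p}(-1)^j a_{j-1}=-a_0+a_1-a_2+\cdots+a_{p-1}.$$ (a) If $\sigma>0$ and $0<a_{2k-1}<2$ for $k=1,2,\dots,p/2$, then $(*)$ has a globally attracting periodic solution $(\bar x_n)_{n\ge -1}$ with period $p$ (not necessarily minimal) such that $\bar x_{2n-1}=0$ for all $n\ge 0$, the sequence $(\bar x_{2n})_{n\ge 0}$ has period $p/2$, and $$\sum_{i=1}^{p/2}\bar x_{2i-2}=\sum_{i=1}^{p/2}a_{2i-1}.$$ (b) If $\sigma<0$ and $0<a_{2k-2}<2$ for $k=1,2,\dots,p/2$, then $(*)$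 has a globally attracting periodic solution $(\bar x_n)_{n\ge -1}$ with period $p$ (not necessarily minimal) such that $\bar x_{2n}=0$ for all $n\ge 0$, the sequence $(\bar x_{2n-1})_{n\ge 0}$ has period $p/2$, and $$\sum_{i=1}^{p/2}\bar x_{2i-1}=\sum_{i=1}^{p/2}a_{2i-2}.$$ -/

import Mathlib

open Filter Topology

/-- `p` is the minimal (least positive) period of the sequence `a`. -/
def IsMinimalPeriod (a : ℕ → ℝ) (p : ℕ) : Prop :=
  IsLeast {q : ℕ | 0 < q ∧ Function.Periodic a q} p

/-- `x` solves `x_{n+1} = x_{n-1} exp (a_n - x_{n-1} - x_n)` for all `n ≥ 0`. A solution is a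
sequence indexed by the integers `n ≥ -1`; the values of `x` at indices below `-1` play no role. -/
def IsSolution (a : ℕ → ℝ) (x : ℤ → ℝ) : Prop :=
  ∀ n : ℕ, x ((n : ℤ) + 1) =
    x ((n : ℤ) - 1) * Real.exp (a n - x ((n : ℤ) - 1) - x (n : ℤ))

/-- The sequence `(x_n)_{n ≥ -1}` is periodic with period `p` (not necessarily minimal). -/
def HasPeriod (x : ℤ → ℝ) (p : ℕ) : Prop :=
  ∀ n : ℤ, -1 ≤ n → x (n + (p : ℤ)) = x n

/-- `xbar` attracts every solution that starts from positive initial values `x_{-1}, x_0`. -/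
def IsGloballyAttracting (a : ℕ → ℝ) (xbar : ℤ → ℝ) : Prop :=
  ∀ x : ℤ → ℝ, IsSolution a x → 0 < x (-1) → 0 < x 0 →
    Tendsto (fun n : ℕ => x (n : ℤ) - xbar (n : ℤ)) atTop (𝓝 0)

/-- `σ = -a_0 + a_1 - a_2 + ⋯ + (-1)^p a_{p-1}`. -/
def alternatingSum (a : ℕ → ℝ) (p : ℕ) : ℝ :=
  ∑ j ∈ Finset.range p, (-1 : ℝ) ^ (j + 1) * a j

/-! Splitting a solution by the parity of its index gives two competing populations: `u` with growth
rates `c`, and `y` with growth rates `b`, where `b` has the larger sum over a period. The quotient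
`u n * exp (-u n) / y n` is multiplied by exactly `exp (c n - b n)` at each step. It therefore tends
to 0, and boundedness of both populations forces `u → 0` (`competitor_tendsto_zero`).

The survivor `y` is then an asymptotically vanishing perturbation of the periodic Ricker equation `z
(n+1) = z n * exp (b n - z n)` with rates in `(0, 2)`. Away from 0, all these Ricker maps contract
one common metric (`rickerWeight_contraction`), so any two positive orbits merge, even under
vanishing perturbations (`ricker_tendsto_sub`). A periodic orbit (`exists_periodic_ricker`),
interleaved with zeros, is the attractor. -/

section Ricker

/-! ### Mean value comparison and perturbed contractions. -/

/-- Cauchy's mean value theorem; `g` serves as the coordinate in which `f` is Lipschitz. -/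
lemma abs_sub_le_mul_of_abs_deriv_le {f f' g g' : ℝ → ℝ} {s : Set ℝ} (hs : s.OrdConnected)
    (hf : ∀ x ∈ s, HasDerivAt f (f' x) x) (hg : ∀ x ∈ s, HasDerivAt g (g' x) x)
    (hpos : ∀ x ∈ s, 0 < g' x) {C : ℝ} (hC : ∀ x ∈ s, |f' x| ≤ C * g' x)
    {x y : ℝ} (hx : x ∈ s) (hy : y ∈ s) : |f x - f y| ≤ C * |g x - g y| := by
  wlog hxy : x < y generalizing x y
  · rcases eq_or_lt_of_le (not_lt.1 hxy) with h | h
    · simp [h]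
    · rw [abs_sub_comm (f x), abs_sub_comm (g x)]
      exact this hy hx h
  have hsub : Set.Icc x y ⊆ s := hs.out hx hy
  obtain ⟨c, hc, h⟩ := exists_ratio_hasDerivAt_eq_ratio_slope f f' hxy
    (fun z hz => (hf z (hsub hz)).continuousAt.continuousWithinAt)
    (fun z hz => hf z (hsub (Set.Ioo_subset_Icc_self hz))) g g'
    (fun z hz => (hg z (hsub hz)).continuousAt.continuousWithinAt)
    (fun z hz => hg z (hsub (Set.Ioo_subset_Icc_self hz)))
  have hcs := hsub (Set.Ioo_subset_Icc_self hc)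
  have hp := hpos c hcs
  have h' : |g y - g x| * |f' c| = |f y - f x| * g' c := by
    rw [← abs_mul, h, abs_mul, abs_of_pos hp]
  rw [abs_sub_comm (f x), abs_sub_comm (g x)]
  refine le_of_mul_le_mul_right ?_ hp
  calc |f y - f x| * g' c = |g y - g x| * |f' c| := h'.symm
    _ ≤ |g y - g x| * (C * g' c) := by gcongr; exact hC c hcs
    _ = C * |g y - g x| * g' c := by ring

lemma tendsto_zero_of_le_mul_add {D e : ℕ → ℝ} {θ : ℝ} (hθ : 0 ≤ θ) (hθ1 : θ < 1)
    (hD : ∀ n, 0 ≤ D n) (he : Tendsto e atTop (𝓝 0)) (h : ∀ n, D (n + 1) ≤ θ * D n + e n) :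
    Tendsto D atTop (𝓝 0) := by
  rw [Metric.tendsto_atTop]
  intro ε hε
  obtain ⟨N, hN⟩ := Metric.tendsto_atTop.1 he ((1 - θ) * (ε / 2))
    (mul_pos (by linarith) (by linarith))
  have hind : ∀ k, D (N + k) ≤ θ ^ k * D N + ε / 2 := by
    intro k
    induction k with
    | zero => simp; linarith
    | succ k ih =>
      have h1 := hN (N + k) (by omega)
      rw [Real.dist_eq, sub_zero] at h1
      have h2 := h (N + k)
      have h3 := mul_le_mul_of_nonneg_left ih hθ
      have h4 := (abs_lt.1 h1).2
      rw [← add_assoc, pow_succ]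
      linarith
  have ht : Tendsto (fun k => θ ^ k * D N) atTop (𝓝 0) := by
    simpa using (tendsto_pow_atTop_nhds_zero_of_lt_one hθ hθ1).mul_const (D N)
  obtain ⟨M, hM⟩ := (ht.eventually_lt_const (half_pos hε)).exists_forall_of_atTop
  refine ⟨N + M, fun n hn => ?_⟩
  obtain ⟨k, rfl⟩ := Nat.exists_eq_add_of_le (show N ≤ n by omega)
  rw [Real.dist_eq, sub_zero, abs_of_nonneg (hD _)]
  linarith [hind k, hM k (by omega)]

/-! ### Elementary bounds for the Ricker map. -/

lemma mul_exp_sub_le_exp (b y : ℝ) : y * Real.exp (b - y) ≤ Real.exp (b - 1) := by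
  have h : y ≤ Real.exp (y - 1) := by linarith [Real.add_one_le_exp (y - 1)]
  calc y * Real.exp (b - y) ≤ Real.exp (y - 1) * Real.exp (b - y) := by gcongr
    _ = Real.exp (b - 1) := by rw [← Real.exp_add]; ring_nf

lemma mul_exp_sub_le_three {b : ℝ} (hb : b ≤ 2) (y : ℝ) : y * Real.exp (b - y) ≤ 3 := by
  refine (mul_exp_sub_le_exp b y).trans ?_
  calc Real.exp (b - 1) ≤ Real.exp 1 := Real.exp_le_exp.2 (by linarith)
    _ ≤ 3 := by linarith [Real.exp_one_lt_d9]

lemma mul_exp_two_sub_le_two {y : ℝ} (hy : 2 ≤ y) : y * Real.exp (2 - y) ≤ 2 := by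
  have h : y / 2 ≤ Real.exp (y - 2) := by linarith [Real.add_one_le_exp (y - 2)]
  have h2 : Real.exp (y - 2) * Real.exp (2 - y) = 1 := by rw [← Real.exp_add]; simp
  nlinarith [Real.exp_pos (2 - y)]

/-- This is the contraction estimate at the critical rate 2. -/
lemma abs_one_sub_mul_ricker_le_one {y : ℝ} (hy : 0 < y) (hy2 : y < 2) :
    |1 - y| * (y * Real.exp (2 - y) - 1) ≤ 1 := by
  rcases le_total 1 y with h | h
  · obtain ⟨t, rfl⟩ : ∃ t, y = 2 - t := ⟨2 - y, by ring⟩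
    have ht0 : 0 ≤ t := by linarith
    have ht1 : t ≤ 1 := by linarith
    have he := Real.exp_bound' ht0 ht1 (n := 3) (by norm_num)
    norm_num [Finset.sum_range_succ, Nat.factorial] at he
    rw [abs_of_nonpos (by linarith), sub_sub_cancel]
    -- With this bound the claim reduces to `(1 - t) * (1 + t) ≤ 1`.
    have h1 : (2 - t) * Real.exp t ≤ 2 + t := by
      have h2 := mul_le_mul_of_nonneg_left he hy.le
      have h3 : 0 ≤ t ^ 3 := by positivity
      have h4 : 0 ≤ t ^ 4 := by positivity
      nlinarith
    nlinarith
  · rw [abs_of_nonneg (by linarith)]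
    have h1 : Real.exp 2 ≤ 7.4 := by
      have : Real.exp 2 = Real.exp 1 * Real.exp 1 := by rw [← Real.exp_add]; norm_num
      rw [this]
      nlinarith [Real.exp_one_lt_d9, Real.exp_one_gt_d9]
    have h2 : Real.exp (2 - y) * (1 + y) ≤ 7.4 := by
      have h3 : 1 + y ≤ Real.exp y := by linarith [Real.add_one_le_exp y]
      calc Real.exp (2 - y) * (1 + y) ≤ Real.exp (2 - y) * Real.exp y := by gcongr
        _ = Real.exp 2 := by rw [← Real.exp_add]; ring_nf
        _ ≤ 7.4 := h1
    have h3 : Real.exp (2 - y) ≤ 4 * (2 - y) := by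
      refine le_of_mul_le_mul_right (h2.trans ?_) (show 0 < 1 + y by linarith)
      nlinarith
    have h4 : y * (1 - y) ≤ 1 / 4 := by nlinarith [sq_nonneg (y - 1 / 2)]
    nlinarith [Real.exp_pos (2 - y)]

/-! ### A metric contracted by all the Ricker maps. -/

/-- Density, with respect to `dy / y`, of a metric contracted by the Ricker maps. -/
def rickerWeight (K y : ℝ) : ℝ := max 1 (K * (y - 1))

/-- Primitive of `rickerWeight K y / y`. -/
noncomputable def rickerCoord (K y : ℝ) : ℝ := ∫ t in (1 : ℝ)..y, rickerWeight K t / t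

lemma one_le_rickerWeight (K y : ℝ) : 1 ≤ rickerWeight K y := le_max_left _ _

lemma hasDerivAt_rickerCoord (K : ℝ) {y : ℝ} (hy : 0 < y) :
    HasDerivAt (rickerCoord K) (rickerWeight K y / y) y := by
  have hc : ∀ t, 0 < t → ContinuousAt (fun t => rickerWeight K t / t) t := by
    intro t ht
    unfold rickerWeight
    exact ContinuousAt.div (by fun_prop) continuousAt_id ht.ne'
  have hm : Measurable (fun t => rickerWeight K t / t) := by
    unfold rickerWeight
    fun_prop
  refine intervalIntegral.integral_hasDerivAt_right ?_
    hm.stronglyMeasurable.stronglyMeasurableAtFilter (hc y hy)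
  refine ContinuousOn.intervalIntegrable fun t ht => (hc t ?_).continuousWithinAt
  exact (lt_min one_pos hy).trans_le ht.1

lemma hasDerivAt_mul_exp_sub (b y : ℝ) :
    HasDerivAt (fun y => y * Real.exp (b - y)) (Real.exp (b - y) * (1 - y)) y := by
  have h := (hasDerivAt_id y).mul ((hasDerivAt_id y).const_sub b).exp
  refine h.congr_deriv ?_
  simp only [id]
  ring

/-- In the coordinate `log y` the Ricker map has derivative `1 - y`, so `|1 - y| * φ (f y) / φ y` is
its dilation in the metric `φ dy / y`, with `φ` the weight. The factor `exp (-δ)` gained from `b ≤ 2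
- δ` is split evenly between `K` and the contraction rate. -/
lemma rickerWeight_contraction {δ m b y : ℝ} (hm : 0 < m) (hδ : 0 < δ) (hb : b ≤ 2 - δ)
    (hy : m ≤ y) :
    |1 - y| * rickerWeight (Real.exp (δ / 2)) (y * Real.exp (b - y)) ≤
      max (1 - m) (Real.exp (-(δ / 2))) * rickerWeight (Real.exp (δ / 2)) y := by
  have hy0 : 0 < y := hm.trans_le hy
  set K := Real.exp (δ / 2) with hK
  set E := Real.exp (-(δ / 2)) with hE
  have hKE : K * E = 1 := by rw [hK, hE, ← Real.exp_add]; simp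
  have hK1 : 1 < K := by rw [hK]; exact Real.one_lt_exp_iff.2 (by linarith)
  have hE0 : 0 < E := Real.exp_pos _
  set θ := max (1 - m) E with hθ
  have hEθ : E ≤ θ := le_max_right _ _
  have hθ0 : 0 < θ := hE0.trans_le hEθ
  have hφ1 := one_le_rickerWeight K y
  have hφ2 : K * (y - 1) ≤ rickerWeight K y := le_max_right _ _
  have hθφ : E ≤ θ * rickerWeight K y := hEθ.trans (le_mul_of_one_le_right hθ0.le hφ1)
  have hbase : |1 - y| ≤ θ * rickerWeight K y := by
    rcases le_total y 1 with h | h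
    · rw [abs_of_nonneg (by linarith)]
      calc 1 - y ≤ 1 - m := by linarith
        _ ≤ θ := le_max_left _ _
        _ ≤ _ := le_mul_of_one_le_right hθ0.le hφ1
    · rw [abs_of_nonpos (by linarith)]
      calc -(1 - y) = E * (K * (y - 1)) := by linear_combination (-(y - 1)) * hKE
        _ ≤ E * rickerWeight K y := by gcongr
        _ ≤ _ := by gcongr
  have hf : y * Real.exp (b - y) ≤ E * E * (y * Real.exp (2 - y)) := by
    calc y * Real.exp (b - y) ≤ y * Real.exp (-(δ / 2) + -(δ / 2) + (2 - y)) := by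
          gcongr; linarith
      _ = _ := by rw [Real.exp_add, Real.exp_add]; ring
  rw [rickerWeight, mul_max_of_nonneg _ _ (abs_nonneg _), mul_one]
  refine max_le hbase ?_
  -- For `y ≥ 2` the image is so small that its weight is 1; for `y < 2` the critical estimate
  -- applies.
  rcases le_or_gt 2 y with h | h
  · refine le_trans (mul_le_of_le_one_right (abs_nonneg _) ?_) hbase
    have h2 := mul_exp_two_sub_le_two h
    have h3 : y * Real.exp (b - y) ≤ E * E * 2 := hf.trans (by gcongr)
    have hE1 : E < 1 := by nlinarith
    calc K * (y * Real.exp (b - y) - 1) ≤ K * (E * E * 2 - 1) := by gcongr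
      _ = 2 * E - K := by linear_combination (2 * E) * hKE
      _ ≤ 1 := by linarith
  · refine le_trans ?_ hθφ
    have h2 := abs_one_sub_mul_ricker_le_one hy0 h
    have hE1 : E * E ≤ 1 := by nlinarith
    calc |1 - y| * (K * (y * Real.exp (b - y) - 1))
        ≤ |1 - y| * (K * (E * E * (y * Real.exp (2 - y) - 1))) := by
          gcongr
          linarith
      _ = E * (|1 - y| * (y * Real.exp (2 - y) - 1)) := by
          linear_combination (E * (|1 - y| * (y * Real.exp (2 - y) - 1))) * hKE
      _ ≤ E := mul_le_of_le_one_right hE0.le h2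

lemma abs_rickerCoord_image_sub_le {δ m b y z : ℝ} (hm : 0 < m) (hδ : 0 < δ) (hb : b ≤ 2 - δ)
    (hy : m ≤ y) (hz : m ≤ z) :
    |rickerCoord (Real.exp (δ / 2)) (y * Real.exp (b - y)) -
        rickerCoord (Real.exp (δ / 2)) (z * Real.exp (b - z))| ≤
      max (1 - m) (Real.exp (-(δ / 2))) *
        |rickerCoord (Real.exp (δ / 2)) y - rickerCoord (Real.exp (δ / 2)) z| := by
  refine abs_sub_le_mul_of_abs_deriv_le (s := Set.Ici m)
    (f := fun y => rickerCoord (Real.exp (δ / 2)) (y * Real.exp (b - y)))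
    (f' := fun x => rickerWeight (Real.exp (δ / 2)) (x * Real.exp (b - x)) /
      (x * Real.exp (b - x)) * (Real.exp (b - x) * (1 - x)))
    Set.ordConnected_Ici (fun x hx => ?_) (fun x hx => hasDerivAt_rickerCoord _ (hm.trans_le hx))
    (fun x hx => ?_) (fun x hx => ?_) hy hz
  · have hx0 : 0 < x := hm.trans_le hx
    exact (hasDerivAt_rickerCoord (Real.exp (δ / 2))
      (mul_pos hx0 (Real.exp_pos (b - x)))).comp x (hasDerivAt_mul_exp_sub b x)
  · exact div_pos (one_pos.trans_le (one_le_rickerWeight _ _)) (hm.trans_le hx)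
  · have hx0 : 0 < x := hm.trans_le hx
    have h := rickerWeight_contraction hm hδ hb hx
    have hw := one_pos.trans_le
      (one_le_rickerWeight (Real.exp (δ / 2)) (x * Real.exp (b - x)))
    have he : rickerWeight (Real.exp (δ / 2)) (x * Real.exp (b - x)) / (x * Real.exp (b - x)) *
        (Real.exp (b - x) * (1 - x)) =
        (1 - x) * rickerWeight (Real.exp (δ / 2)) (x * Real.exp (b - x)) / x := by
      have := (Real.exp_pos (b - x)).ne'
      field_simp
    rw [he, abs_div, abs_mul, abs_of_pos hw, abs_of_pos hx0, ← mul_div_assoc]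
    gcongr

/-- The logarithm of the image has derivative 1 in the rate, and the weight is at most `K * (3 - 1)`
because the image is at most 3. -/
lemma abs_rickerCoord_param_sub_le {K z g h : ℝ} (hK : 1 ≤ K) (hz : 0 < z) (hg : g ≤ 2)
    (hh : h ≤ 2) :
    |rickerCoord K (z * Real.exp (g - z)) - rickerCoord K (z * Real.exp (h - z))| ≤
      2 * K * |g - h| := by
  refine abs_sub_le_mul_of_abs_deriv_le (s := Set.Iic 2) (g := fun x => x)
    (f := fun b => rickerCoord K (z * Real.exp (b - z)))
    Set.ordConnected_Iic (f' := fun b => rickerWeight K (z * Real.exp (b - z)))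
    (fun x hx => ?_) (fun x hx => hasDerivAt_id x) (fun x hx => one_pos) (fun x hx => ?_) hg hh
  · have hp : 0 < z * Real.exp (x - z) := mul_pos hz (Real.exp_pos _)
    have h1 := (((hasDerivAt_id x).sub_const z).exp).const_mul z
    have h2 := (hasDerivAt_rickerCoord K hp).comp x h1
    refine h2.congr_deriv ?_
    simp only [id, mul_one]
    field_simp
  · have h3 := mul_exp_sub_le_three (Set.mem_Iic.1 hx) z
    rw [abs_of_pos (one_pos.trans_le (one_le_rickerWeight _ _)), mul_one]
    refine max_le (by linarith) ?_
    nlinarith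

lemma abs_sub_le_mul_abs_rickerCoord_sub {K M y z : ℝ} (hy : 0 < y) (hyM : y ≤ M) (hz : 0 < z)
    (hzM : z ≤ M) : |y - z| ≤ M * |rickerCoord K y - rickerCoord K z| := by
  refine abs_sub_le_mul_of_abs_deriv_le (s := Set.Ioc 0 M) (f := fun x => x)
    Set.ordConnected_Ioc (f' := fun _ => 1) (fun x hx => hasDerivAt_id x)
    (fun x hx => hasDerivAt_rickerCoord K hx.1)
    (fun x hx => div_pos (one_pos.trans_le (one_le_rickerWeight _ _)) hx.1)
    (fun x hx => ?_) ⟨hy, hyM⟩ ⟨hz, hzM⟩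
  have h1 := one_le_rickerWeight K x
  rw [abs_one, ← mul_div_assoc, le_div_iff₀ hx.1, one_mul]
  nlinarith [hx.1, hx.2]

/-! ### Merging of orbits and the periodic orbit. -/

lemma ricker_bounded {g y : ℕ → ℝ} {β : ℝ} (hβ : 0 < β) (hg : ∀ n, β ≤ g n) (hg2 : ∀ n, g n ≤ 2)
    (hy0 : 0 < y 0) (hy : ∀ n, y (n + 1) = y n * Real.exp (g n - y n)) :
    ∃ m M : ℝ, 0 < m ∧ ∀ n, m ≤ y n ∧ y n ≤ M := by
  set M := max (y 0) 3
  set m := min (y 0) (β * Real.exp (-M))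
  have hm : 0 < m := lt_min hy0 (mul_pos hβ (Real.exp_pos _))
  refine ⟨m, M, hm, fun n => ?_⟩
  induction n with
  | zero => exact ⟨min_le_left _ _, le_max_left _ _⟩
  | succ n ih =>
    rw [hy]
    refine ⟨?_, (mul_exp_sub_le_three (hg2 n) _).trans (le_max_right _ _)⟩
    have hyn : 0 < y n := hm.trans_le ih.1
    -- Below `β` the orbit does not decrease; above it, one step cannot fall under `β * exp (-M)`.
    rcases le_total (y n) β with h | h
    · refine ih.1.trans (le_mul_of_one_le_right hyn.le (Real.one_le_exp ?_))
      linarith [hg n]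
    · refine (min_le_right _ _).trans ?_
      gcongr
      linarith [hg n, ih.2]

lemma ricker_tendsto_sub {g h y z : ℕ → ℝ} {β δ : ℝ} (hβ : 0 < β) (hδ : 0 < δ)
    (hg : ∀ n, β ≤ g n ∧ g n ≤ 2 - δ) (hh : ∀ n, β ≤ h n ∧ h n ≤ 2 - δ)
    (hgh : Tendsto (fun n => g n - h n) atTop (𝓝 0)) (hy0 : 0 < y 0) (hz0 : 0 < z 0)
    (hy : ∀ n, y (n + 1) = y n * Real.exp (g n - y n))
    (hz : ∀ n, z (n + 1) = z n * Real.exp (h n - z n)) :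
    Tendsto (fun n => y n - z n) atTop (𝓝 0) := by
  obtain ⟨m₁, M₁, hm₁, hy'⟩ := ricker_bounded hβ (fun n => (hg n).1)
    (fun n => by linarith [(hg n).2]) hy0 hy
  obtain ⟨m₂, M₂, hm₂, hz'⟩ := ricker_bounded hβ (fun n => (hh n).1)
    (fun n => by linarith [(hh n).2]) hz0 hz
  set m := min m₁ m₂
  set M := max M₁ M₂
  have hm : 0 < m := lt_min hm₁ hm₂
  set K := Real.exp (δ / 2)
  set θ := max (1 - m) (Real.exp (-(δ / 2)))
  have hθ0 : 0 ≤ θ := (Real.exp_pos _).le.trans (le_max_right _ _)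
  have hθ1 : θ < 1 := max_lt (by linarith) (Real.exp_lt_one_iff.2 (by linarith))
  have hK : 1 ≤ K := Real.one_le_exp (by linarith)
  have hD : Tendsto (fun n => |rickerCoord K (y n) - rickerCoord K (z n)|) atTop (𝓝 0) := by
    refine tendsto_zero_of_le_mul_add hθ0 hθ1 (fun n => abs_nonneg _)
      (e := fun n => 2 * K * |g n - h n|) ?_ (fun n => ?_)
    · simpa using hgh.abs.const_mul (2 * K)
    · rw [hy, hz]
      refine (abs_sub_le _ (rickerCoord K (z n * Real.exp (g n - z n))) _).trans (add_le_add ?_ ?_)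
      · exact abs_rickerCoord_image_sub_le hm hδ (hg n).2 ((min_le_left _ _).trans (hy' n).1)
          ((min_le_right _ _).trans (hz' n).1)
      · exact abs_rickerCoord_param_sub_le hK (hm₂.trans_le (hz' n).1) (by linarith [(hg n).2])
          (by linarith [(hh n).2])
  refine squeeze_zero_norm (fun n => ?_) (by simpa using hD.const_mul M)
  exact abs_sub_le_mul_abs_rickerCoord_sub (hm₁.trans_le (hy' n).1)
    ((hy' n).2.trans (le_max_left _ _)) (hm₂.trans_le (hz' n).1)
    ((hz' n).2.trans (le_max_right _ _))

/-- The orbit of the nonautonomous Ricker equation with initial value `s`. -/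
noncomputable def rickerOrbit (b : ℕ → ℝ) (s : ℝ) : ℕ → ℝ
  | 0 => s
  | n + 1 => rickerOrbit b s n * Real.exp (b n - rickerOrbit b s n)

lemma continuous_rickerOrbit (b : ℕ → ℝ) (n : ℕ) : Continuous fun s => rickerOrbit b s n := by
  induction n with
  | zero => exact continuous_id
  | succ n ih => simp only [rickerOrbit]; fun_prop

lemma periodic_uniform_bounds {b : ℕ → ℝ} {q : ℕ} (hq : 0 < q) (hb : Function.Periodic b q)
    (hb02 : ∀ n, 0 < b n ∧ b n < 2) :
    ∃ β δ : ℝ, 0 < β ∧ 0 < δ ∧ ∀ n, β ≤ b n ∧ b n ≤ 2 - δ := by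
  have hne : (Finset.range q).Nonempty := ⟨0, by simpa using hq⟩
  obtain ⟨i, -, hi⟩ := Finset.exists_min_image (Finset.range q) b hne
  obtain ⟨j, -, hj⟩ := Finset.exists_max_image (Finset.range q) b hne
  refine ⟨b i, 2 - b j, (hb02 i).1, by linarith [(hb02 j).2], fun n => ?_⟩
  have hn : n % q ∈ Finset.range q := Finset.mem_range.2 (Nat.mod_lt _ hq)
  rw [← hb.map_mod_nat n]
  exact ⟨hi _ hn, by linarith [hj _ hn]⟩

lemma exists_periodic_ricker {b : ℕ → ℝ} {q : ℕ} (hq : 0 < q) (hb : Function.Periodic b q)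
    (hb02 : ∀ n, 0 < b n ∧ b n < 2) :
    ∃ z : ℕ → ℝ, 0 < z 0 ∧ (∀ n, z (n + 1) = z n * Real.exp (b n - z n)) ∧
      Function.Periodic z q ∧ ∑ i ∈ Finset.range q, z i = ∑ i ∈ Finset.range q, b i := by
  obtain ⟨β, δ, hβ, hδ, hbb⟩ := periodic_uniform_bounds hq hb hb02
  set m := β * Real.exp (-3)
  have hm : 0 < m := mul_pos hβ (Real.exp_pos _)
  have hinv : ∀ n, ∀ s ∈ Set.Icc m 3, rickerOrbit b s n ∈ Set.Icc m 3 := by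
    intro n s hs
    induction n with
    | zero => exact hs
    | succ n ih =>
      rw [rickerOrbit]
      refine ⟨?_, mul_exp_sub_le_three (hb02 n).2.le _⟩
      rcases le_total (rickerOrbit b s n) β with h | h
      · refine ih.1.trans (le_mul_of_one_le_right (hm.le.trans ih.1) (Real.one_le_exp ?_))
        linarith [(hbb n).1]
      · refine mul_le_mul h (Real.exp_le_exp.2 ?_) (Real.exp_pos _).le (hβ.le.trans h)
        linarith [(hb02 n).1, ih.2]
  have hm3 : m ≤ 3 := by
    have h1 : Real.exp (-3) ≤ 1 := Real.exp_le_one_iff.2 (by norm_num)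
    have h2 : m ≤ β := mul_le_of_le_one_right hβ.le h1
    linarith [hbb 0, hb02 0]
  -- The map over one period sends `[m, 3]` to itself; its fixed point starts the periodic orbit.
  obtain ⟨s, hs, hfix⟩ := exists_mem_Icc_isFixedPt_of_mapsTo
    (continuous_rickerOrbit b q).continuousOn hm3 (fun s hs => hinv q s hs)
  have hper : Function.Periodic (rickerOrbit b s) q := by
    intro n
    induction n with
    | zero => rw [zero_add]; exact hfix
    | succ n ih => rw [add_right_comm, rickerOrbit, rickerOrbit, ih, hb n]
  refine ⟨rickerOrbit b s, hm.trans_le hs.1, fun n => rfl, hper, ?_⟩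
  -- At `n = q` the exponential must equal 1, which gives the equality of sums.
  have hprod : ∀ n, rickerOrbit b s n = s *
      Real.exp (∑ i ∈ Finset.range n, b i - ∑ i ∈ Finset.range n, rickerOrbit b s i) := by
    intro n
    induction n with
    | zero => simp [rickerOrbit]
    | succ n ih =>
      rw [Finset.sum_range_succ, Finset.sum_range_succ, add_sub_add_comm, Real.exp_add,
        ← mul_assoc, ← ih, rickerOrbit]
  have h1 := hprod q
  rw [show rickerOrbit b s q = s from hfix] at h1
  have hs0 : s ≠ 0 := (hm.trans_le hs.1).ne'
  have h2 := (Real.exp_eq_one_iff _).1 ((mul_eq_left₀ hs0).1 h1.symm)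
  linarith

lemma ricker_attracting {b v y z : ℕ → ℝ} {q : ℕ} (hq : 0 < q) (hb : Function.Periodic b q)
    (hb02 : ∀ n, 0 < b n ∧ b n < 2) (hv0 : ∀ n, 0 ≤ v n) (hv : Tendsto v atTop (𝓝 0))
    (hypos : ∀ n, 0 < y n) (hz0 : 0 < z 0)
    (hy : ∀ n, y (n + 1) = y n * Real.exp (b n - y n - v n))
    (hz : ∀ n, z (n + 1) = z n * Real.exp (b n - z n)) :
    Tendsto (fun n => y n - z n) atTop (𝓝 0) := by
  obtain ⟨β, δ, hβ, hδ, hbb⟩ := periodic_uniform_bounds hq hb hb02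
  have hzpos : ∀ n, 0 < z n := by
    intro n
    induction n with
    | zero => exact hz0
    | succ n ih => rw [hz]; exact mul_pos ih (Real.exp_pos _)
  -- From `N` on, the effective rates `b - v` lie in `[β / 2, 2 - δ]`.
  obtain ⟨N, hN⟩ := (hv.eventually_lt_const (half_pos hβ)).exists_forall_of_atTop
  rw [← tendsto_add_atTop_iff_nat N]
  refine ricker_tendsto_sub (g := fun n => b (n + N) - v (n + N)) (h := fun n => b (n + N))
    (y := fun n => y (n + N)) (z := fun n => z (n + N)) (half_pos hβ) hδ (fun n => ?_)
    (fun n => ?_) ?_ (hypos _) (hzpos _) (fun n => ?_) (fun n => ?_)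
  · have := hN (n + N) (by omega)
    constructor <;> linarith [hbb (n + N), hv0 (n + N)]
  · constructor <;> linarith [hbb (n + N)]
  · simpa using ((tendsto_add_atTop_iff_nat N).2 hv).neg
  · rw [add_right_comm, hy]; ring_nf
  · rw [add_right_comm, hz]

/-! ### Extinction of the weaker competitor. -/

lemma tendsto_sum_periodic_atBot {d : ℕ → ℝ} {q : ℕ} (hq : 0 < q) (hd : Function.Periodic d q)
    (hsum : ∑ i ∈ Finset.range q, d i < 0) :
    Tendsto (fun n => ∑ i ∈ Finset.range n, d i) atTop atBot := by
  set s := ∑ i ∈ Finset.range q, d i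
  have hstep : ∀ k r, ∑ i ∈ Finset.range (r + q * k), d i =
      k * s + ∑ i ∈ Finset.range r, d i := by
    intro k r
    induction k with
    | zero => simp
    | succ k ih =>
      rw [show r + q * (k + 1) = q + (r + q * k) by ring, Finset.sum_range_add]
      have : ∀ i, d (q + i) = d i := fun i => by rw [add_comm, hd]
      simp only [this, ih]
      push_cast
      ring
  obtain ⟨C, hC⟩ := ((Finset.range q).image fun r => ∑ i ∈ Finset.range r, d i).bddAbove
  refine tendsto_atBot_mono (f := fun n => ((n / q : ℕ) : ℝ) * s + C) (fun n => ?_) ?_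
  · rw [← Nat.mod_add_div n q, hstep, Nat.mod_add_div]
    gcongr
    exact hC (by simpa using ⟨n % q, Nat.mod_lt _ hq, rfl⟩)
  · refine tendsto_atBot_add_const_right _ _ (Tendsto.atTop_mul_const_of_neg hsum ?_)
    exact tendsto_natCast_atTop_atTop.comp (Nat.tendsto_div_const_atTop hq.ne')

lemma competitor_tendsto_zero {b c u y : ℕ → ℝ} {q : ℕ} (hq : 0 < q) (hb : Function.Periodic b q)
    (hc : Function.Periodic c q) (hb2 : ∀ n, b n ≤ 2)
    (hsum : ∑ i ∈ Finset.range q, c i < ∑ i ∈ Finset.range q, b i)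
    (hupos : ∀ n, 0 < u n) (hypos : ∀ n, 0 < y n)
    (hu : ∀ n, u (n + 1) = u n * Real.exp (c n - u n - y n))
    (hy : ∀ n, y (n + 1) = y n * Real.exp (b n - y n - u (n + 1))) :
    Tendsto u atTop (𝓝 0) := by
  have hw : ∀ n, u n * Real.exp (-u n) = y n * (u 0 / y 0 * Real.exp (-u 0)) *
      Real.exp (∑ i ∈ Finset.range n, (c i - b i)) := by
    intro n
    induction n with
    | zero =>
      have := (hypos 0).ne'
      simp
      field_simp
    | succ n ih =>
      have e1 : u (n + 1) * Real.exp (-u (n + 1)) =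
          (u n * Real.exp (-u n)) * Real.exp (c n - y n - u (n + 1)) := by
        nth_rewrite 1 [hu]
        rw [mul_assoc, mul_assoc, ← Real.exp_add, ← Real.exp_add]
        ring_nf
      have e2 : Real.exp (c n - y n - u (n + 1)) =
          Real.exp (b n - y n - u (n + 1)) * Real.exp (c n - b n) := by
        rw [← Real.exp_add]; ring_nf
      rw [e1, ih, Finset.sum_range_succ, Real.exp_add, e2, hy]
      ring
  obtain ⟨C, hC⟩ : ∃ C, ∀ n, c n ≤ C := by
    obtain ⟨C, hC⟩ := ((Finset.range q).image c).bddAbove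
    refine ⟨C, fun n => ?_⟩
    rw [← hc.map_mod_nat n]
    exact hC (by simpa using ⟨n % q, Nat.mod_lt _ hq, rfl⟩)
  have hyB : ∀ n, y (n + 1) ≤ 3 := fun n => by
    rw [hy, sub_right_comm]
    exact mul_exp_sub_le_three (by linarith [hb2 n, hupos (n + 1)]) _
  have huB : ∀ n, u (n + 1) ≤ Real.exp (C - 1) := fun n => by
    rw [hu, sub_right_comm]
    exact (mul_exp_sub_le_exp _ _).trans (Real.exp_le_exp.2 (by linarith [hC n, hypos n]))
  have hS : Tendsto (fun n => Real.exp (∑ i ∈ Finset.range n, (c i - b i))) atTop (𝓝 0) :=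
    Real.tendsto_exp_atBot.comp (tendsto_sum_periodic_atBot hq (hc.sub hb)
      (by rw [Finset.sum_sub_distrib]; linarith))
  rw [← tendsto_add_atTop_iff_nat 1]
  have hS' := ((tendsto_add_atTop_iff_nat 1).2 hS).const_mul
    (3 * (u 0 / y 0 * Real.exp (-u 0)) * Real.exp (Real.exp (C - 1)))
  rw [mul_zero] at hS'
  refine squeeze_zero (fun n => (hupos _).le) (fun n => ?_) hS'
  have hA : 0 < u 0 / y 0 * Real.exp (-u 0) :=
    mul_pos (div_pos (hupos 0) (hypos 0)) (Real.exp_pos _)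
  calc u (n + 1) = u (n + 1) * Real.exp (-u (n + 1)) * Real.exp (u (n + 1)) := by
        rw [mul_assoc, ← Real.exp_add]; simp
    _ = y (n + 1) * (u 0 / y 0 * Real.exp (-u 0)) *
      Real.exp (∑ i ∈ Finset.range (n + 1), (c i - b i)) * Real.exp (u (n + 1)) := by rw [hw]
    _ ≤ 3 * (u 0 / y 0 * Real.exp (-u 0)) *
      Real.exp (∑ i ∈ Finset.range (n + 1), (c i - b i)) * Real.exp (Real.exp (C - 1)) := by
        gcongr
        · exact hyB n
        · exact huB n
    _ = _ := by ring

end Ricker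

section Interleaving

/-! ### Interleaving the two subsequences. -/

lemma tendsto_of_even_odd {f : ℕ → ℝ} {l : Filter ℝ} (h0 : Tendsto (fun n => f (2 * n)) atTop l)
    (h1 : Tendsto (fun n => f (2 * n + 1)) atTop l) : Tendsto f atTop l := by
  intro s hs
  obtain ⟨N, hN⟩ := (h0.eventually hs).exists_forall_of_atTop
  obtain ⟨M, hM⟩ := (h1.eventually hs).exists_forall_of_atTop
  refine mem_atTop_sets.2 ⟨2 * (N + M), fun n hn => ?_⟩
  rcases Nat.even_or_odd' n with ⟨k, rfl | rfl⟩
  · exact hN k (by omega)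
  · exact hM k (by omega)

lemma alternatingSum_two_mul (a : ℕ → ℝ) (q : ℕ) :
    alternatingSum a (2 * q) =
      ∑ i ∈ Finset.range q, a (2 * i + 1) - ∑ i ∈ Finset.range q, a (2 * i) := by
  unfold alternatingSum
  induction q with
  | zero => simp
  | succ q ih =>
    rw [show 2 * (q + 1) = 2 * q + 1 + 1 by ring, Finset.sum_range_succ, Finset.sum_range_succ, ih,
      Finset.sum_range_succ, Finset.sum_range_succ]
    rw [pow_succ, pow_succ, pow_succ, pow_mul]
    norm_num
    ring

lemma sum_range_succ_periodic {f : ℕ → ℝ} {q : ℕ} (hf : Function.Periodic f q) :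
    ∑ i ∈ Finset.range q, f (i + 1) = ∑ i ∈ Finset.range q, f i := by
  have h1 := Finset.sum_range_succ f q
  rw [Finset.sum_range_succ', show f q = f 0 by simpa using hf 0] at h1
  linarith

lemma sum_Icc_one_eq_sum_range (f : ℕ → ℝ) (q : ℕ) :
    ∑ i ∈ Finset.Icc 1 q, f i = ∑ i ∈ Finset.range q, f (i + 1) := by
  rw [Finset.range_eq_Ico, Finset.sum_Ico_add' f 0 q 1, zero_add, Finset.Ico_add_one_right_eq_Icc]

lemma IsSolution.pos {a : ℕ → ℝ} {x : ℤ → ℝ} (hx : IsSolution a x) (h1 : 0 < x (-1))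
    (h0 : 0 < x 0) (n : ℕ) : 0 < x ((n : ℤ) - 1) ∧ 0 < x n := by
  induction n with
  | zero => simpa using ⟨h1, h0⟩
  | succ n ih =>
    push_cast
    rw [add_sub_cancel_right, hx n]
    exact ⟨ih.2, mul_pos ih.1 (Real.exp_pos _)⟩

lemma competitor_dynamics {b c u y z : ℕ → ℝ} {q : ℕ} (hq : 0 < q) (hb : Function.Periodic b q)
    (hc : Function.Periodic c q) (hb02 : ∀ n, 0 < b n ∧ b n < 2)
    (hsum : ∑ i ∈ Finset.range q, c i < ∑ i ∈ Finset.range q, b i)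
    (hupos : ∀ n, 0 < u n) (hypos : ∀ n, 0 < y n) (hz0 : 0 < z 0)
    (hu : ∀ n, u (n + 1) = u n * Real.exp (c n - u n - y n))
    (hy : ∀ n, y (n + 1) = y n * Real.exp (b n - y n - u (n + 1)))
    (hz : ∀ n, z (n + 1) = z n * Real.exp (b n - z n)) :
    Tendsto u atTop (𝓝 0) ∧ Tendsto (fun n => y n - z n) atTop (𝓝 0) := by
  have h := competitor_tendsto_zero hq hb hc (fun n => (hb02 n).2.le) hsum hupos hypos hu hy
  exact ⟨h, ricker_attracting hq hb hb02 (fun n => (hupos _).le)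
    ((tendsto_add_atTop_iff_nat 1).2 h) hypos hz0 hy hz⟩

/-- The integer sequence equal to `z` at even indices and to `0` at odd ones. -/
def evenExtension (z : ℕ → ℝ) (n : ℤ) : ℝ := if Even n then z (n / 2).toNat else 0

lemma evenExtension_two_mul (z : ℕ → ℝ) (n : ℕ) : evenExtension z (2 * (n : ℤ)) = z n := by
  simp [evenExtension]

lemma evenExtension_of_odd (z : ℕ → ℝ) {n : ℤ} (hn : Odd n) : evenExtension z n = 0 := by
  simp [evenExtension, hn]

lemma evenExtension_add_two_mul {z : ℕ → ℝ} {q : ℕ} (hz : Function.Periodic z q) {n : ℤ}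
    (hn : -1 ≤ n) : evenExtension z (n + 2 * (q : ℤ)) = evenExtension z n := by
  rcases Int.even_or_odd' n with ⟨k, rfl | rfl⟩
  · lift k to ℕ using by omega
    rw [← mul_add, ← Nat.cast_add, evenExtension_two_mul, evenExtension_two_mul, hz]
  · rw [evenExtension_of_odd _ ⟨k + q, by ring⟩, evenExtension_of_odd _ ⟨k, rfl⟩]

theorem exists_attracting_even {a : ℕ → ℝ} {q : ℕ} (hq : 0 < q)
    (ha : Function.Periodic a (2 * q)) (hσ : 0 < alternatingSum a (2 * q))
    (h02 : ∀ n, 0 < a (2 * n + 1) ∧ a (2 * n + 1) < 2) :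
    ∃ z : ℕ → ℝ, IsSolution a (evenExtension z) ∧ IsGloballyAttracting a (evenExtension z) ∧
      Function.Periodic z q ∧
      ∑ i ∈ Finset.range q, z i = ∑ i ∈ Finset.range q, a (2 * i + 1) := by
  have hb : Function.Periodic (fun n => a (2 * n + 1)) q := fun n => by
    simp only [mul_add, add_right_comm, ha _]
  have hc : Function.Periodic (fun n => a (2 * n)) q := fun n => by simp only [mul_add, ha _]
  rw [alternatingSum_two_mul, sub_pos] at hσ
  obtain ⟨z, hz0, hz, hzp, hzs⟩ := exists_periodic_ricker hq hb h02
  refine ⟨z, fun n => ?_, fun x hx h1 h0 => ?_, hzp, hzs⟩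
  · rcases Nat.even_or_odd' n with ⟨k, rfl | rfl⟩
    · rw [evenExtension_of_odd _ ⟨k, by push_cast; ring⟩,
        evenExtension_of_odd _ ⟨(k : ℤ) - 1, by push_cast; ring⟩, zero_mul]
    · rw [show ((2 * k + 1 : ℕ) : ℤ) + 1 = 2 * ((k + 1 : ℕ) : ℤ) by push_cast; ring,
        show ((2 * k + 1 : ℕ) : ℤ) - 1 = 2 * (k : ℤ) by push_cast; ring,
        evenExtension_of_odd _ (n := ((2 * k + 1 : ℕ) : ℤ)) ⟨k, by push_cast; ring⟩,
        evenExtension_two_mul, evenExtension_two_mul, sub_zero, hz]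
  · have hpos := hx.pos h1 h0
    obtain ⟨hu, hy⟩ := competitor_dynamics (u := fun n => x (2 * (n : ℤ) - 1))
      (y := fun n => x (2 * (n : ℤ))) hq hb hc h02 hσ
      (fun n => by simpa using (hpos (2 * n)).1) (fun n => by simpa using (hpos (2 * n)).2) hz0
      (fun n => by
        have := hx (2 * n)
        push_cast at this
        rw [← this]; push_cast; ring_nf)
      (fun n => by
        have := hx (2 * n + 1)
        push_cast at this
        rw [add_sub_cancel_right] at this
        push_cast
        rw [show 2 * ((n : ℤ) + 1) - 1 = 2 * n + 1 by ring, ← this]; ring_nf) hz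
    refine tendsto_of_even_odd ?_ ?_
    · simpa [evenExtension_two_mul] using hy
    · refine ((tendsto_add_atTop_iff_nat 1).2 hu).congr fun n => ?_
      rw [evenExtension_of_odd _ ⟨n, by push_cast; ring⟩, sub_zero]
      push_cast; ring_nf

theorem exists_attracting_odd {a : ℕ → ℝ} {q : ℕ} (hq : 0 < q)
    (ha : Function.Periodic a (2 * q)) (hσ : alternatingSum a (2 * q) < 0)
    (h02 : ∀ n, 0 < a (2 * n) ∧ a (2 * n) < 2) :
    ∃ z : ℕ → ℝ, IsSolution a (fun n => evenExtension z (n + 1)) ∧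
      IsGloballyAttracting a (fun n => evenExtension z (n + 1)) ∧
      Function.Periodic z q ∧
      ∑ i ∈ Finset.range q, z i = ∑ i ∈ Finset.range q, a (2 * i) := by
  have hc : Function.Periodic (fun n => a (2 * n + 1)) q := fun n => by
    simp only [mul_add, add_right_comm, ha _]
  have hb : Function.Periodic (fun n => a (2 * n)) q := fun n => by simp only [mul_add, ha _]
  have hb' : Function.Periodic (fun n => a (2 * (n + 1))) q := fun n => by
    simp only
    rw [add_right_comm n q 1, mul_add 2 (n + 1) q, ha]
  rw [alternatingSum_two_mul, sub_neg, ← sum_range_succ_periodic hb] at hσ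
  obtain ⟨z, hz0, hz, hzp, hzs⟩ := exists_periodic_ricker hq hb h02
  refine ⟨z, fun n => ?_, fun x hx h1 h0 => ?_, hzp, hzs⟩
  · rcases Nat.even_or_odd' n with ⟨k, rfl | rfl⟩
    · simp only
      rw [show ((2 * k : ℕ) : ℤ) + 1 + 1 = 2 * ((k + 1 : ℕ) : ℤ) by push_cast; ring,
        show ((2 * k : ℕ) : ℤ) - 1 + 1 = 2 * (k : ℤ) by push_cast; ring,
        evenExtension_of_odd _ (n := ((2 * k : ℕ) : ℤ) + 1) ⟨k, by push_cast; ring⟩,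
        evenExtension_two_mul, evenExtension_two_mul, sub_zero, hz]
    · simp only
      rw [evenExtension_of_odd _ ⟨(k : ℤ) + 1, by push_cast; ring⟩,
        evenExtension_of_odd _ ⟨(k : ℤ), by push_cast; ring⟩, zero_mul]
  · have hpos := hx.pos h1 h0
    -- The survivor is read from index 1, not -1, so that `u` moves first; hence the shift by one in
    -- `b` and `z`.
    obtain ⟨hu, hy⟩ := competitor_dynamics (u := fun n => x (2 * (n : ℤ)))
      (y := fun n => x (2 * (n : ℤ) + 1)) (z := fun n => z (n + 1)) hq hb' hc (fun n => h02 _) hσ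
      (fun n => by simpa using (hpos (2 * n)).2) (fun n => by simpa using (hpos (2 * n + 1)).2)
      (by rw [hz]; exact mul_pos hz0 (Real.exp_pos _))
      (fun n => by
        have := hx (2 * n + 1)
        push_cast at this
        rw [add_sub_cancel_right] at this
        rw [← this]; push_cast; ring_nf)
      (fun n => by
        have := hx (2 * (n + 1))
        push_cast at this
        push_cast
        rw [this, show 2 * ((n : ℤ) + 1) - 1 = 2 * n + 1 by ring]) (fun n => hz _)
    refine tendsto_of_even_odd ?_ ?_
    · refine hu.congr fun n => ?_
      simp only
      rw [evenExtension_of_odd _ ⟨n, by push_cast; ring⟩, sub_zero]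
      push_cast; ring_nf
    · refine hy.congr fun n => ?_
      simp only
      rw [show ((2 * n + 1 : ℕ) : ℤ) + 1 = 2 * ((n + 1 : ℕ) : ℤ) by push_cast; ring,
        evenExtension_two_mul]
      push_cast; ring_nf

end Interleaving

/-! ### Assembly and reindexing. -/

theorem theorem4p4 (a : ℕ → ℝ) (p : ℕ) (hp : IsMinimalPeriod a p) (hpe : Even p) :
    (0 < alternatingSum a p →
      (∀ k ∈ Finset.Icc 1 (p / 2), 0 < a (2 * k - 1) ∧ a (2 * k - 1) < 2) →
      ∃ xbar : ℤ → ℝ, IsSolution a xbar ∧ HasPeriod xbar p ∧ IsGloballyAttracting a xbar ∧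
        (∀ n : ℕ, xbar (2 * (n : ℤ) - 1) = 0) ∧
        Function.Periodic (fun n : ℕ => xbar (2 * (n : ℤ))) (p / 2) ∧
        ∑ i ∈ Finset.Icc 1 (p / 2), xbar (2 * (i : ℤ) - 2) =
          ∑ i ∈ Finset.Icc 1 (p / 2), a (2 * i - 1)) ∧
    (alternatingSum a p < 0 →
      (∀ k ∈ Finset.Icc 1 (p / 2), 0 < a (2 * k - 2) ∧ a (2 * k - 2) < 2) →
      ∃ xbar : ℤ → ℝ, IsSolution a xbar ∧ HasPeriod xbar p ∧ IsGloballyAttracting a xbar ∧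
        (∀ n : ℕ, xbar (2 * (n : ℤ)) = 0) ∧
        Function.Periodic (fun n : ℕ => xbar (2 * (n : ℤ) - 1)) (p / 2) ∧
        ∑ i ∈ Finset.Icc 1 (p / 2), xbar (2 * (i : ℤ) - 1) =
          ∑ i ∈ Finset.Icc 1 (p / 2), a (2 * i - 2)) := by 
  obtain ⟨⟨hp0, ha⟩, -⟩ := hp
  obtain ⟨q, rfl⟩ := hpe.exists_two_nsmul
  rw [smul_eq_mul] at *
  have hq : 0 < q := by omega
  rw [Nat.mul_div_cancel_left q two_pos]
  refine ⟨fun hσ h => ?_, fun hσ h => ?_⟩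
  · obtain ⟨z, hsol, hatt, hper, hsum⟩ := exists_attracting_even hq ha hσ fun n => by
      -- The bounds are given on one period only; periodicity extends them to all `n`.
      have h1 := h (n % q + 1) (Finset.mem_Icc.2 ⟨by omega, Nat.mod_lt _ hq⟩)
      have hb : Function.Periodic (fun n => a (2 * n + 1)) q := fun n => by
        simp only [mul_add, add_right_comm, ha _]
      rwa [show 2 * (n % q + 1) - 1 = 2 * (n % q) + 1 by omega, hb.map_mod_nat n] at h1
    refine ⟨evenExtension z, hsol, fun n hn => ?_, hatt, fun n => ?_, ?_, ?_⟩
    · push_cast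
      exact evenExtension_add_two_mul hper hn
    · exact evenExtension_of_odd _ ⟨(n : ℤ) - 1, by ring⟩
    · simpa only [evenExtension_two_mul] using hper
    · rw [sum_Icc_one_eq_sum_range (fun i => evenExtension z (2 * (i : ℤ) - 2)),
        sum_Icc_one_eq_sum_range (fun i => a (2 * i - 1))]
      convert hsum using 2 with i hi i hi
      rw [← evenExtension_two_mul z i]
      push_cast; ring_nf
      rfl
  · obtain ⟨z, hsol, hatt, hper, hsum⟩ := exists_attracting_odd hq ha hσ fun n => by
      have h1 := h (n % q + 1) (Finset.mem_Icc.2 ⟨by omega, Nat.mod_lt _ hq⟩)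
      have hb : Function.Periodic (fun n => a (2 * n)) q := fun n => by simp only [mul_add, ha _]
      rwa [show 2 * (n % q + 1) - 2 = 2 * (n % q) by omega, hb.map_mod_nat n] at h1
    refine ⟨fun n => evenExtension z (n + 1), hsol, fun n hn => ?_, hatt, fun n => ?_, ?_, ?_⟩
    · push_cast
      rw [add_right_comm]
      exact evenExtension_add_two_mul hper (by omega)
    · exact evenExtension_of_odd _ ⟨n, by ring⟩
    · simpa only [sub_add_cancel, evenExtension_two_mul] using hper
    · simp only [sub_add_cancel, evenExtension_two_mul]
      rw [sum_Icc_one_eq_sum_range z, sum_range_succ_periodic hper,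
        sum_Icc_one_eq_sum_range (fun i => a (2 * i - 2))]
      exact hsum
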